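/- Let $m\ge 1$ be an integer. Let $w_s(x)=e^{\gamma_s x}r_s(x)$, $1\le s\le m$, where $\gamma_s\in\mathbb R$ and $r_s\in C^{m-s}(\mathbb R)$ is strictly positive and $1$-periodic. Let $\mathcal U_m$ be the complex span of $u_1,\dots,u_m$, where $$u_i(x)=w_1(x)\int_0^x w_2(x_2)\int_0^{x_2}w_3(x_3)\cdots\int_0^{x_{i-1}}w_i(x_i)\,dx_i\cdots dx_2 .$$ A function $\varphi:\mathbb R\to\mathbb C$ is a *PEB-spline (periodic exponential B-spline) of order $m$* if, for some such weights, $\varphi\in C^{m-2}(\mathbb R)$ (no condition if $m=1$), $\varphi$ coincides on each interval $(j,j+1)$, $j\in\mathbb Z$, with an element of $\mathcal U_m$, $\varphi$ is right-continuous (relevant only if $m=1$), and $\operatorname{supp}\varphi=[k,k+m]$ for some $k\in\mathbb Z$. For $1\le p\le\infty$ let $$V^p(\varphi)=\Big\{f\in L^p(\mathbb R): f(x)=\sum_{\ell\in\mathbb Z}c_\ell\,\varphi(x-\ell)\text{ for all }x\in\mathbb R,\ (c_\ell)\in\ell^p(\mathbb Z)\Big\},$$ where the sum is locally finite, so that $f$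 is defined at every point. For $f\in V^p(\varphi)$ and $0\le s\le m-1$, the value $f^{(s)}(x)$ is understood as the right-sided limit $\lim_{y\searrow x}f^{(s)}(y)$ (this matters only for $s=m-1$ and $x\in\mathbb Z$). **Theorem.** Let $\varphi$ be a PEB-spline of order $m\ge1$. Let $X=\{x_j:j\in\mathbb Z\}\subseteq\mathbb R$, with $x_j<x_{j+1}$ for all $j$, be a separated set, i.e. $\inf_{x\ne y\in X}|x-y|>0$, and let $\mu_X:X\to\{0,\dots,m-1\}$. If $$\mathfrak{mg}(X,\mu_X)=\max\Big\{\sup_{j\in\mathbb Z}\frac{x_{j+1}-x_j}{1+\mu_X(x_j)},\ \sup_{j\in\mathbb Z}\frac{x_{j+1}-x_j}{1+\mu_X(x_{j+1})}\Big\}<1,$$ then $(X,\mu_X)$ is a uniqueness set for $V^p(\varphi)$ for every $1\le p\le\infty$; that is, for $f\in V^p(\varphi)$, $$f^{(s)}(x)=0\ \text{ for all }x\in X\text{ and }0\le s\le\mu_X(x)\quad\Longleftrightarrow\quad f\equiv0 .$$ -/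

import Mathlib

open Set Filter Topology MeasureTheory
open scoped ENNReal

noncomputable section

/-- For weights `w 1, w 2, …`, the iterated integral
`w j (x) * ∫_0^x w (j+1) (x_1) ∫_0^{x_1} w (j+2) (x_2) ⋯ ∫_0^{x_{k-1}} w (j+k) (x_k) dx_k ⋯ dx_1`. -/
def iteratedWeightIntegral (w : ℕ → ℝ → ℝ) : ℕ → ℕ → ℝ → ℝ
  | j, 0 => w j
  | j, k + 1 => fun x => w j x * ∫ t in (0 : ℝ)..x, iteratedWeightIntegral w (j + 1) k t

/-- The functions `u_1, …, u_m` of the extended complete Chebyshev system with weights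
`w 1, …, w m`: `u_i (x) = w_1 (x) ∫_0^x w_2 ⋯ ∫ w_i`. Here `i : Fin m` stands for `u_{i+1}`. -/
def eccFunction (w : ℕ → ℝ → ℝ) (m : ℕ) (i : Fin m) : ℝ → ℂ :=
  fun x => (iteratedWeightIntegral w 1 (i : ℕ) x : ℂ)

/-- The ECC-space: the complex span of `u_1, …, u_m`. -/
def eccSpace (w : ℕ → ℝ → ℝ) (m : ℕ) : Submodule ℂ (ℝ → ℂ) :=
  Submodule.span ℂ (Set.range (eccFunction w m))

/-- `w 1, …, w m` are periodic exponential weights of order `m`: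
`w_s (x) = exp (γ_s x) r_s (x)` with `r_s` positive, `1`-periodic and of class `C^{m-s}`. -/
def IsPeriodicExponentialWeights (m : ℕ) (w : ℕ → ℝ → ℝ) : Prop :=
  ∃ (γ : ℕ → ℝ) (r : ℕ → ℝ → ℝ), ∀ s : ℕ, 1 ≤ s → s ≤ m →
    ContDiff ℝ ((m - s : ℕ) : WithTop ℕ∞) (r s) ∧
    Function.Periodic (r s) 1 ∧
    (∀ x, 0 < r s x) ∧
    ∀ x, w s x = Real.exp (γ s * x) * r s x

/-- `f` is a Chebyshev spline of order `m` with integer knots for the weights `w`: it is of class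
`C^{m-2}` (no condition if `m = 1`) and belongs to the ECC-space on every interval between
consecutive knots. Values at the knots are right-sided limits; this is automatic for `m ≥ 2`. -/
structure IsChebyshevSpline (w : ℕ → ℝ → ℝ) (m : ℕ) (f : ℝ → ℂ) : Prop where
  contDiff : 2 ≤ m → ContDiff ℝ ((m - 2 : ℕ) : WithTop ℕ∞) f
  piecewise : ∀ j : ℤ, ∃ u ∈ eccSpace w m, EqOn f u (Ioo (j : ℝ) (j + 1))
  rightContinuous : ∀ x : ℝ, ContinuousWithinAt f (Ici x) x

/-- `φ` is a periodic exponential B-spline of order `m`: a Chebyshev spline with integer knots for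
periodic exponential weights, whose support is an interval `[k, k + m]` with `k` an integer.
(For given weights and `k` such a spline is unique up to a scalar factor.) -/
def IsPEBSpline (m : ℕ) (φ : ℝ → ℂ) : Prop :=
  ∃ w : ℕ → ℝ → ℝ, IsPeriodicExponentialWeights m w ∧ IsChebyshevSpline w m φ ∧
    ∃ k : ℤ, tsupport φ = Icc (k : ℝ) (k + m)

/-- The shift-invariant space `V^p(φ)`. For a compactly supported generator the sum is locally
finite, so its elements are defined pointwise. -/
def shiftInvariantSpace (p : ℝ≥0∞) (φ : ℝ → ℂ) : Set (ℝ → ℂ) :=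
  {f | MemLp f p volume ∧ ∃ c : ℤ → ℂ, Memℓp c p ∧ ∀ x, f x = ∑' l : ℤ, c l * φ (x - l)}

/-- The sample `f^{(s)}(x)` has the value `v`, where samples are right-sided limits: this is the
ordinary value of `f^{(s)}` at `x` wherever `f` is `C^s` near `x`, and the right-sided limit where
`f^{(s)}` has a jump. -/
def HasSample (f : ℝ → ℂ) (s : ℕ) (x : ℝ) (v : ℂ) : Prop :=
  Tendsto (iteratedDeriv s f) (𝓝[>] x) (𝓝 v)

/-- `(X, μ)` is a uniqueness set for the space `V`: the samples `f^{(s)}(x)`, `x ∈ X`,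
`0 ≤ s ≤ μ x`, of a function `f` in `V` all vanish if and only if `f = 0`. -/
def IsUniquenessSet (X : Set ℝ) (μ : X → ℕ) (V : Set (ℝ → ℂ)) : Prop :=
  ∀ f ∈ V, (∀ x : X, ∀ s ≤ μ x, HasSample f s x 0) ↔ f = 0

/-- `X` is separated: its distinct points have a positive minimal distance. -/
def IsSeparatedSet (X : Set ℝ) : Prop :=
  ∃ δ : ℝ, 0 < δ ∧ X.Pairwise fun a b => δ ≤ |a - b|

/-- The weighted maximum gap of `X = {x_j : j ∈ ℤ}` (enumerated increasingly by `x`) with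
multiplicities `μ`, as an extended real number. -/
def weightedMaxGap {X : Set ℝ} (x : ℤ ≃o X) (μ : X → ℕ) : EReal :=
  max (⨆ j : ℤ, ((((x (j + 1) : ℝ) - x j) / (1 + μ (x j)) : ℝ) : EReal))
    (⨆ j : ℤ, ((((x (j + 1) : ℝ) - x j) / (1 + μ (x (j + 1))) : ℝ) : EReal))

end

/-! Periodic exponential weights make the ECC-space invariant under integer shifts, so every element
of `V^p(φ)` is a Chebyshev spline with integer knots. Its real and imaginary parts are real splines
`g`, and each is shown to vanish.

Two estimates compete on an interval `[A, B]` with integer ends that contains no knot interval on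
which `g` vanishes identically. Dividing by the first weight and differentiating lowers the order by
one, so Rolle's theorem bounds the zeros of `g` by `B - A + m - 2` (`IsSeparatedZeros.card_le`,
`IsRealSpline.card_zeros_le`). The gap condition yields `B - A ≤ θ (Z + m)` with `θ < 1`, where `Z`
counts the prescribed zeros in `(A, B)` (`exists_points_of_gap_le`).

Together they bound `B - A`, so for `g ≠ 0` there is a maximal such interval, flanked by knot
intervals on which `g = 0`. Being `C^{m-2}`, `g` has zeros of order `m - 1` at both ends. Counting
these too gives `Z + m ≤ B - A ≤ θ (Z + m)`, a contradiction (`IsRealSpline.eq_zero_of_gap`). -/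

/-! ### Extended complete Chebyshev systems -/

/-- `w j, …, w (j + m - 1)` are positive weights with the smoothness of an extended complete
Chebyshev system of order `m`. -/
def IsSmoothWeights (w : ℕ → ℝ → ℝ) (j m : ℕ) : Prop :=
  ∀ i < m, ContDiff ℝ ((m - 1 - i : ℕ) : WithTop ℕ∞) (w (j + i)) ∧ ∀ x, 0 < w (j + i) x

theorem IsPeriodicExponentialWeights.isSmoothWeights {m : ℕ} {w : ℕ → ℝ → ℝ}
    (hw : IsPeriodicExponentialWeights m w) : IsSmoothWeights w 1 m := by
  obtain ⟨γ, r, h⟩ := hw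
  intro i hi
  obtain ⟨h1, -, h3, h4⟩ := h (1 + i) (by omega) (by omega)
  have : w (1 + i) = fun x => Real.exp (γ (1 + i) * x) * r (1 + i) x := funext h4
  rw [this]
  refine ⟨?_, fun x => mul_pos (Real.exp_pos _) (h3 x)⟩
  rw [show m - 1 - i = m - (1 + i) by omega]
  exact ContDiff.mul (by fun_prop) h1

theorem IsSmoothWeights.tail {w : ℕ → ℝ → ℝ} {j m : ℕ} (h : IsSmoothWeights w j (m + 1)) :
    IsSmoothWeights w (j + 1) m := by
  intro i hi
  have := h (i + 1) (by omega)
  rwa [show j + (i + 1) = j + 1 + i by ring, show m + 1 - 1 - (i + 1) = m - 1 - i by omega] at this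

theorem IsSmoothWeights.contDiff {w : ℕ → ℝ → ℝ} {j m : ℕ} (h : IsSmoothWeights w j (m + 1)) :
    ContDiff ℝ (m : WithTop ℕ∞) (w j) := by
  simpa using (h 0 (by omega)).1

theorem IsSmoothWeights.pos {w : ℕ → ℝ → ℝ} {j m : ℕ} (h : IsSmoothWeights w j (m + 1)) (x : ℝ) :
    0 < w j x := by
  simpa using (h 0 (by omega)).2 x

theorem contDiff_succ_primitive {n : ℕ} {g : ℝ → ℝ} (hg : ContDiff ℝ (n : WithTop ℕ∞) g) :
    ContDiff ℝ ((n + 1 : ℕ) : WithTop ℕ∞) (fun x => ∫ t in (0 : ℝ)..x, g t) := by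
  have hd : ∀ x, HasDerivAt (fun x => ∫ t in (0 : ℝ)..x, g t) (g x) x := fun x =>
    intervalIntegral.integral_hasDerivAt_right (hg.continuous.intervalIntegrable _ _)
      (hg.continuous.stronglyMeasurableAtFilter _ _) hg.continuous.continuousAt
  push_cast
  rw [contDiff_succ_iff_deriv]
  refine ⟨fun x => (hd x).differentiableAt, by simp, ?_⟩
  rwa [funext fun x => (hd x).deriv]

theorem contDiff_iteratedWeightIntegral {w : ℕ → ℝ → ℝ} {j m k : ℕ} (h : IsSmoothWeights w j m)
    (hk : k < m) : ContDiff ℝ ((m - 1 : ℕ) : WithTop ℕ∞) (iteratedWeightIntegral w j k) := by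
  induction k generalizing j m with
  | zero => simpa [iteratedWeightIntegral] using (h 0 hk).1
  | succ k ih =>
    obtain ⟨n, rfl⟩ : ∃ n, m = n + 2 := ⟨m - 2, by omega⟩
    have := contDiff_succ_primitive (ih h.tail (by omega))
    exact ContDiff.mul h.contDiff this

/-- The real combination of the first `m` functions of the system with weights `w j, w (j+1), …`
with coefficients `a`. -/
noncomputable def eccSum (w : ℕ → ℝ → ℝ) (j m : ℕ) (a : ℕ → ℝ) (x : ℝ) : ℝ :=
  ∑ i ∈ Finset.range m, a i * iteratedWeightIntegral w j i x

theorem contDiff_eccSum {w : ℕ → ℝ → ℝ} {j m : ℕ} (h : IsSmoothWeights w j m) (a : ℕ → ℝ) :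
    ContDiff ℝ ((m - 1 : ℕ) : WithTop ℕ∞) (eccSum w j m a) := by
  refine ContDiff.sum fun i hi => contDiff_const.mul ?_
  exact contDiff_iteratedWeightIntegral h (by simpa using hi)

theorem eccSum_succ {w : ℕ → ℝ → ℝ} {j m : ℕ} (h : IsSmoothWeights w j (m + 1)) (a : ℕ → ℝ)
    (x : ℝ) : eccSum w j (m + 1) a x =
      w j x * (a 0 + ∫ t in (0 : ℝ)..x, eccSum w (j + 1) m (fun i => a (i + 1)) t) := by
  unfold eccSum
  rw [intervalIntegral.integral_finsetSum, Finset.sum_range_succ', mul_add, add_comm,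
    Finset.mul_sum]
  · simp only [iteratedWeightIntegral, intervalIntegral.integral_const_mul]
    congr 1
    · ring
    · exact Finset.sum_congr rfl fun i _ => by ring
  · intro i hi
    exact (continuous_const.mul (contDiff_iteratedWeightIntegral h.tail
      (by simpa using hi)).continuous).intervalIntegrable _ _

/-- The reduction behind the inductions on the order: dividing out the first weight and
differentiating removes that weight and the coefficient `a 0`. -/
theorem hasDerivAt_eccSum_div {w : ℕ → ℝ → ℝ} {j m : ℕ} (h : IsSmoothWeights w j (m + 1))
    (a : ℕ → ℝ) (x : ℝ) : HasDerivAt (fun x => (w j x)⁻¹ * eccSum w j (m + 1) a x)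
      (eccSum w (j + 1) m (fun i => a (i + 1)) x) x := by
  have hc := (contDiff_eccSum h.tail (fun i => a (i + 1))).continuous
  have : (fun x => (w j x)⁻¹ * eccSum w j (m + 1) a x) =
      fun x => a 0 + ∫ t in (0 : ℝ)..x, eccSum w (j + 1) m (fun i => a (i + 1)) t := by
    funext y
    rw [eccSum_succ h, inv_mul_cancel_left₀ (h.pos y).ne']
  rw [this]
  exact (intervalIntegral.integral_hasDerivAt_right (hc.intervalIntegrable _ _)
      (hc.stronglyMeasurableAtFilter _ _) hc.continuousAt).const_add _

theorem iteratedDeriv_mul_eq_zero {f v : ℝ → ℝ} {x : ℝ} {s : ℕ}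
    (hv : ContDiff ℝ (s : WithTop ℕ∞) v) (hf : ContDiff ℝ (s : WithTop ℕ∞) f)
    (h : ∀ i ≤ s, iteratedDeriv i f x = 0) : iteratedDeriv s (fun y => v y * f y) x = 0 := by
  rw [iteratedDeriv_fun_mul hv.contDiffAt hf.contDiffAt]
  refine Finset.sum_eq_zero fun i _ => ?_
  rw [h _ (by omega), mul_zero]

theorem IsSmoothWeights.contDiff_inv {w : ℕ → ℝ → ℝ} {j m : ℕ} (h : IsSmoothWeights w j (m + 1)) :
    ContDiff ℝ (m : WithTop ℕ∞) (fun x => (w j x)⁻¹) :=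
  h.contDiff.inv fun x => (h.pos x).ne'

/-- The system is extended Chebyshev: only the zero combination has a zero of order `m`. -/
theorem eccSum_eq_zero {w : ℕ → ℝ → ℝ} {j m : ℕ} (h : IsSmoothWeights w j m) {a : ℕ → ℝ} {y : ℝ}
    (hy : ∀ s < m, iteratedDeriv s (eccSum w j m a) y = 0) (x : ℝ) : eccSum w j m a x = 0 := by
  induction m generalizing j a x with
  | zero => simp [eccSum]
  | succ m ih =>
    have hc := contDiff_eccSum h a
    have hd := hasDerivAt_eccSum_div h a
    have hz : ∀ x, eccSum w (j + 1) m (fun i => a (i + 1)) x = 0 := by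
      refine ih h.tail fun s hs => ?_
      rw [← funext fun x => (hd x).deriv, ← iteratedDeriv_succ']
      exact iteratedDeriv_mul_eq_zero (h.contDiff_inv.of_le (by exact_mod_cast hs))
        (hc.of_le (by exact_mod_cast hs)) fun i hi => hy i (by omega)
    have hy0 : eccSum w j (m + 1) a y = 0 := by simpa using hy 0 (by omega)
    rw [eccSum_succ h] at hy0 ⊢
    simp only [hz, intervalIntegral.integral_zero, add_zero, mul_eq_zero, (h.pos _).ne',
      false_or] at hy0 ⊢
    exact hy0

theorem eccSum_eq_zero_of_eqOn_Ioo {w : ℕ → ℝ → ℝ} {j m : ℕ} (h : IsSmoothWeights w j m)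
    {a : ℕ → ℝ} {c d : ℝ} (hcd : c < d) (h0 : ∀ x ∈ Ioo c d, eccSum w j m a x = 0) (x : ℝ) :
    eccSum w j m a x = 0 := by
  obtain ⟨y, hy⟩ := nonempty_Ioo.2 hcd
  refine eccSum_eq_zero h (y := y) (fun s _ => ?_) x
  have : eccSum w j m a =ᶠ[𝓝 y] fun _ => (0 : ℝ) :=
    eventually_of_mem (isOpen_Ioo.mem_nhds hy) h0
  rw [this.iteratedDeriv_eq, iteratedDeriv_fun_const_zero]

/-- The ECC-space of periodic exponential weights is invariant under integer shifts. -/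
theorem exists_eccSum_comp_sub {w : ℕ → ℝ → ℝ} {j m : ℕ} (h : IsSmoothWeights w j m) (l : ℝ)
    (hl : ∀ i < m, ∃ c, ∀ x, w (j + i) (x - l) = c * w (j + i) x) (a : ℕ → ℝ) :
    ∃ b : ℕ → ℝ, ∀ x, eccSum w j m a (x - l) = eccSum w j m b x := by
  induction m generalizing j a with
  | zero => exact ⟨0, fun x => by simp [eccSum]⟩
  | succ m ih =>
    obtain ⟨b, hb⟩ := ih h.tail (fun i hi => by
      have := hl (i + 1) (by omega)
      rwa [show j + (i + 1) = j + 1 + i by ring] at this) (fun i => a (i + 1))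
    obtain ⟨c, hc⟩ := hl 0 (by omega)
    rw [add_zero] at hc
    have hbc := (contDiff_eccSum h.tail b).continuous
    -- Substitution turns the integral over `[0, x - l]` into one over `[l, x]`; the missing piece
    -- over `[0, l]` is a constant, absorbed into the leading coefficient.
    let d := a 0 - ∫ t in (0 : ℝ)..l, eccSum w (j + 1) m b t
    refine ⟨fun i => if i = 0 then c * d else c * b (i - 1), fun x => ?_⟩
    rw [eccSum_succ h, eccSum_succ h, hc]
    have h1 : ∫ t in (0 : ℝ)..(x - l), eccSum w (j + 1) m (fun i => a (i + 1)) t =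
        ∫ t in l..x, eccSum w (j + 1) m b t := by
      simp only [← hb]
      rw [intervalIntegral.integral_comp_sub_right
        (fun t => eccSum w (j + 1) m (fun i => a (i + 1)) t), sub_self]
    have h2 : ∀ t, eccSum w (j + 1) m (fun i => c * b i) t = c * eccSum w (j + 1) m b t := by
      intro t
      simp only [eccSum, Finset.mul_sum, mul_assoc]
    have h3 := intervalIntegral.integral_add_adjacent_intervals (μ := volume)
      (hbc.intervalIntegrable 0 l) (hbc.intervalIntegrable l x)
    simp only [h1, if_true, Nat.add_one_ne_zero, if_false, Nat.add_sub_cancel, h2,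
      intervalIntegral.integral_const_mul, d]
    rw [← h3]
    ring

/-! ### Rolle's theorem and zero counting for real splines -/

/-- `f` is a real Chebyshev spline of order `m` with integer knots and weights
`w j, …, w (j + m - 1)`; the values at the knots are only restricted by continuity for `2 ≤ m`. -/
structure IsRealSpline (w : ℕ → ℝ → ℝ) (j m : ℕ) (f : ℝ → ℝ) : Prop where
  contDiff : 2 ≤ m → ContDiff ℝ ((m - 2 : ℕ) : WithTop ℕ∞) f
  piecewise : ∀ k : ℤ, ∃ a : ℕ → ℝ, EqOn f (eccSum w j m a) (Ioo (k : ℝ) (k + 1))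

theorem IsRealSpline.deriv_div {w : ℕ → ℝ → ℝ} {j n : ℕ} {f : ℝ → ℝ}
    (hw : IsSmoothWeights w j (n + 3)) (hf : IsRealSpline w j (n + 3) f) :
    IsRealSpline w (j + 1) (n + 2) (deriv fun x => (w j x)⁻¹ * f x) where
  contDiff _ := by
    have h1 : ContDiff ℝ ((n + 1 : ℕ) : WithTop ℕ∞) f := hf.contDiff (by omega)
    have h2 : ContDiff ℝ ((n + 1 : ℕ) : WithTop ℕ∞) fun x => (w j x)⁻¹ * f x :=
      (hw.contDiff_inv.of_le (by exact_mod_cast Nat.le_succ _)).mul h1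
    push_cast at h2
    exact (contDiff_succ_iff_deriv.1 h2).2.2
  piecewise k := by
    obtain ⟨a, ha⟩ := hf.piecewise k
    refine ⟨fun i => a (i + 1), fun x hx => ?_⟩
    rw [← (hasDerivAt_eccSum_div hw a x).deriv]
    refine EventuallyEq.deriv_eq (eventually_of_mem (isOpen_Ioo.mem_nhds hx) fun y hy => ?_)
    simp only [ha hy]

/-- The mean value theorem on either side of `y` gives slopes of opposite sign, hence a zero of the
derivative between them. The points `p` and `q` are kept as witnesses that the derivative is not
identically zero on either side of `r`, so separation survives differentiation. -/
theorem exists_deriv_sign_change {F : ℝ → ℝ} (hF : ContDiff ℝ 1 F) {a b y : ℝ} (hy : y ∈ Ioo a b)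
    (ha : F a = 0) (hb : F b = 0) (hFy : F y ≠ 0) :
    ∃ p q r : ℝ, a < p ∧ p < r ∧ r < q ∧ q < b ∧ deriv F p ≠ 0 ∧ deriv F r = 0 ∧
      deriv F q ≠ 0 := by
  have hd : Differentiable ℝ F := hF.differentiable one_ne_zero
  have hc : Continuous (deriv F) := hF.continuous_deriv le_rfl
  obtain ⟨p, hp, hp'⟩ := exists_deriv_eq_slope F hy.1 hF.continuous.continuousOn
    hd.differentiableOn
  obtain ⟨q, hq, hq'⟩ := exists_deriv_eq_slope F hy.2 hF.continuous.continuousOn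
    hd.differentiableOn
  rw [ha, sub_zero] at hp'
  rw [hb, zero_sub] at hq'
  have h1 : 0 < y - a := sub_pos.2 hy.1
  have h2 : 0 < b - y := sub_pos.2 hy.2
  have hpq : p < q := hp.2.trans hq.1
  have hp0 : deriv F p ≠ 0 := by rw [hp']; exact div_ne_zero hFy h1.ne'
  have hq0 : deriv F q ≠ 0 := by rw [hq']; exact div_ne_zero (neg_ne_zero.2 hFy) h2.ne'
  obtain ⟨r, hr, hr0⟩ : ∃ r ∈ Icc p q, deriv F r = 0 := by
    rcases lt_or_gt_of_ne hFy with h | h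
    · exact intermediate_value_Icc hpq.le hc.continuousOn
        ⟨by rw [hp']; exact (div_neg_of_neg_of_pos h h1).le,
          by rw [hq']; exact (div_pos (neg_pos.2 h) h2).le⟩
    · exact intermediate_value_Icc' hpq.le hc.continuousOn
        ⟨by rw [hq']; exact (div_neg_of_neg_of_pos (neg_neg_of_pos h) h2).le,
          by rw [hp']; exact (div_pos h h1).le⟩
  refine ⟨p, q, r, hp.1, lt_of_le_of_ne hr.1 ?_, lt_of_le_of_ne hr.2 ?_, hq.2, hp0, hr0, hq0⟩
  · rintro rfl; exact hp0 hr0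
  · rintro rfl; exact hq0 hr0

/-- `t 0 ≤ … ≤ t (N - 1)` are zeros of `f`, listed with multiplicities less than `m`, such that
`f` does not vanish identically between consecutive distinct ones. -/
structure IsSeparatedZeros (m : ℕ) (f : ℝ → ℝ) (t : ℕ → ℝ) (N : ℕ) : Prop where
  mono : ∀ i k, i ≤ k → k < N → t i ≤ t k
  zero : ∀ i s, i + s < N → t i = t (i + s) → iteratedDeriv s f (t i) = 0
  mult : ∀ i, i + (m - 1) < N → t i < t (i + (m - 1))
  sep : ∀ i, i + 1 < N → t i < t (i + 1) → ∃ y ∈ Ioo (t i) (t (i + 1)), f y ≠ 0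

/-- Coinciding neighbours keep their point, with multiplicity lowered by one; distinct neighbours
produce a new zero strictly between them. One zero is lost in total. -/
theorem IsSeparatedZeros.exists_deriv_div {w : ℕ → ℝ → ℝ} {j n N : ℕ} {f : ℝ → ℝ} {t : ℕ → ℝ}
    (hw : IsSmoothWeights w j (n + 3)) (hf : IsRealSpline w j (n + 3) f)
    (ht : IsSeparatedZeros (n + 3) f t (N + 1)) :
    ∃ t' : ℕ → ℝ, IsSeparatedZeros (n + 2) (deriv fun x => (w j x)⁻¹ * f x) t' N ∧
      ∀ i < N, t' i ∈ Icc (t i) (t (i + 1)) := by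
  set F : ℝ → ℝ := fun x => (w j x)⁻¹ * f x with hFdef
  have hfc : ContDiff ℝ ((n + 1 : ℕ) : WithTop ℕ∞) f := hf.contDiff (by omega)
  have hvc : ContDiff ℝ ((n + 1 : ℕ) : WithTop ℕ∞) fun x => (w j x)⁻¹ :=
    hw.contDiff_inv.of_le (by exact_mod_cast Nat.le_succ _)
  have hFc : ContDiff ℝ 1 F := (hvc.mul hfc).of_le (by exact_mod_cast Nat.le_add_left _ _)
  have hF0 : ∀ y, f y = 0 → F y = 0 := fun y hy => by simp [hFdef, hy]
  have hFne : ∀ y, f y ≠ 0 → F y ≠ 0 := fun y hy => mul_ne_zero (inv_ne_zero (hw.pos y).ne') hy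
  have hft : ∀ i < N + 1, f (t i) = 0 := fun i hi => by simpa using ht.zero i 0 hi rfl
  have key : ∀ i, ∃ r, i < N → (t i = t (i + 1) ∧ r = t i) ∨
      (t i < r ∧ r < t (i + 1) ∧ deriv F r = 0 ∧ (∃ p ∈ Ioo (t i) r, deriv F p ≠ 0) ∧
        ∃ q ∈ Ioo r (t (i + 1)), deriv F q ≠ 0) := by
    intro i
    by_cases hi : i < N
    · rcases (ht.mono i (i + 1) (by omega) (by omega)).eq_or_lt with h | h
      · exact ⟨t i, fun _ => Or.inl ⟨h, rfl⟩⟩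
      · obtain ⟨y, hy, hy0⟩ := ht.sep i (by omega) h
        obtain ⟨p, q, r, h1, h2, h3, h4, h5, h6, h7⟩ := exists_deriv_sign_change hFc hy
          (hF0 _ (hft i (by omega))) (hF0 _ (hft (i + 1) (by omega))) (hFne y hy0)
        exact ⟨r, fun _ => Or.inr ⟨h1.trans h2, h3.trans h4, h6, ⟨p, ⟨h1, h2⟩, h5⟩,
          q, ⟨h3, h4⟩, h7⟩⟩
    · exact ⟨0, fun h => absurd h hi⟩
  choose t' ht' using key
  have hmem : ∀ i < N, t' i ∈ Icc (t i) (t (i + 1)) := by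
    intro i hi
    rcases ht' i hi with ⟨h1, h2⟩ | ⟨h1, h2, -⟩
    · rw [h2]; exact ⟨le_rfl, h1.le⟩
    · exact ⟨h1.le, h2.le⟩
  have hmul : ∀ i s, i + (s + 1) < N → t' i = t' (i + (s + 1)) →
      t' i = t i ∧ t i = t (i + (s + 1) + 1) := by
    intro i s his h
    have h1 := hmem i (by omega)
    have h2 := hmem _ his
    have h3 := ht.mono (i + 1) (i + (s + 1)) (by omega) (by omega)
    rcases ht' i (by omega) with ⟨h4, h5⟩ | ⟨h4, h5, -⟩
    · rcases ht' _ his with ⟨h6, h7⟩ | ⟨h6, h7, -⟩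
      · exact ⟨h5, by rw [← h6, ← h7, ← h, h5]⟩
      · linarith [h1.2]
    · linarith [h2.1]
  refine ⟨t', ⟨?_, ?_, ?_, ?_⟩, hmem⟩
  · intro i k hik hk
    rcases hik.eq_or_lt with rfl | hlt
    · exact le_rfl
    · exact ((hmem i (by omega)).2.trans (ht.mono _ _ hlt (by omega))).trans (hmem k hk).1
  · have hzero : ∀ i s, i + s < N → t i = t (i + s + 1) →
        iteratedDeriv s (deriv F) (t i) = 0 := by
      intro i s his h
      -- The multiplicity bound keeps the derivatives used below within the available smoothness
      -- `C^{n+1}`.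
      have hs : s < n + 1 := by
        by_contra hs
        have h1 := ht.mult i (by omega)
        have h2 := ht.mono (i + (n + 3 - 1)) (i + s + 1) (by omega) (by omega)
        linarith
      rw [← iteratedDeriv_succ']
      refine iteratedDeriv_mul_eq_zero (hvc.of_le (by exact_mod_cast hs))
        (hfc.of_le (by exact_mod_cast hs)) fun k hk => ?_
      refine ht.zero i k (by omega) (le_antisymm (ht.mono _ _ (by omega) (by omega)) ?_)
      rw [h]
      exact ht.mono _ _ (by omega) (by omega)
    intro i s his h
    rcases s with _ | s
    · rcases ht' i (by omega) with ⟨h1, h2⟩ | ⟨-, -, h3, -⟩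
      · rw [h2]
        exact hzero i 0 his h1
      · simpa using h3
    · obtain ⟨h1, h2⟩ := hmul i s his h
      rw [h1]
      exact hzero i _ his h2
  · intro i hi
    refine lt_of_le_of_ne (((hmem i (by omega)).2.trans
      (ht.mono _ _ (by omega) (by omega))).trans (hmem _ hi).1) fun h => ?_
    obtain ⟨-, h2⟩ := hmul i n hi h
    exact (ht.mult i (by omega)).ne h2
  · intro i hi hlt
    rcases ht' i (by omega) with ⟨h1, h2⟩ | ⟨-, -, -, -, q, hq, hq0⟩
    · rcases ht' (i + 1) hi with ⟨h3, h4⟩ | ⟨-, -, -, ⟨p, hp, hp0⟩, -⟩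
      · rw [h2, h4, h1] at hlt
        exact absurd hlt (lt_irrefl _)
      · exact ⟨p, ⟨(hmem i (by omega)).2.trans_lt hp.1, hp.2⟩, hp0⟩
    · exact ⟨q, ⟨hq.1, hq.2.trans_le (hmem (i + 1) hi).1⟩, hq0⟩

/-- By Rolle, the derivative of the quotient by the first weight has a zero. That derivative is `a
1` times a positive weight, so `a 1 = 0`, and then `a 0 = 0`. -/
theorem IsRealSpline.eq_zero_of_two_zeros {w : ℕ → ℝ → ℝ} {j : ℕ} {f : ℝ → ℝ}
    (hw : IsSmoothWeights w j 2) (hf : IsRealSpline w j 2 f) {k : ℤ} {c d : ℝ}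
    (hc : (k : ℝ) ≤ c) (hcd : c < d) (hd : d ≤ k + 1) (hfc : f c = 0) (hfd : f d = 0) :
    ∀ y ∈ Ioo (k : ℝ) (k + 1), f y = 0 := by
  obtain ⟨a, ha⟩ := hf.piecewise k
  have hcont : Continuous f := (hf.contDiff le_rfl).continuous
  have hEc : Continuous (eccSum w j 2 a) := (contDiff_eccSum hw a).continuous
  have heq : EqOn f (eccSum w j 2 a) (Icc (k : ℝ) (k + 1)) := by
    rw [← closure_Ioo (by linarith : (k : ℝ) ≠ k + 1)]
    exact ha.closure hcont hEc
  have hz : ∀ x, iteratedWeightIntegral w (j + 1) 0 x ≠ 0 := fun x => (hw.tail.pos x).ne'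
  have hg := hasDerivAt_eccSum_div hw a
  obtain ⟨e, -, he0⟩ := exists_hasDerivAt_eq_zero hcd
    (fun x _ => (hg x).continuousAt.continuousWithinAt)
    (by rw [← heq ⟨hc, by linarith⟩, ← heq ⟨by linarith, hd⟩, hfc, hfd, mul_zero, mul_zero])
    (fun x _ => hg x)
  have ha1 : a 1 = 0 := by
    simpa [eccSum, hz e] using he0
  have hform : ∀ x, eccSum w j 2 a x = w j x * a 0 := by
    intro x
    rw [eccSum_succ hw]
    simp [eccSum, ha1]
  have ha0 : a 0 = 0 := by
    have := heq ⟨hc, by linarith⟩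
    rw [hfc, hform] at this
    simpa [(hw.pos c).ne'] using this.symm
  intro y hy
  rw [ha hy, hform, ha0, mul_zero]

/-- A spline of order `m` on `L` knot intervals has at most `L + m - 2` separated zeros. -/
theorem IsSeparatedZeros.card_le {w : ℕ → ℝ → ℝ} {n : ℕ} {j N : ℕ} {f : ℝ → ℝ} {t : ℕ → ℝ}
    (hw : IsSmoothWeights w j (n + 2)) (hf : IsRealSpline w j (n + 2) f)
    (ht : IsSeparatedZeros (n + 2) f t N) {A B : ℤ} (hAB : A < B)
    (hmem : ∀ i < N, t i ∈ Icc (A : ℝ) B) : (N : ℤ) ≤ B - A + n := by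
  induction n generalizing j N f t with
  | zero =>
    have hlt : ∀ i k, i < k → k < N → t i < t k := fun i k hik hk =>
      (ht.mult i (by omega)).trans_le (ht.mono (i + 1) k hik hk)
    -- Each zero is assigned to a knot interval; the minimum puts a zero at `B` into the last one.
    -- Two zeros in the same interval would contradict separation, so the assignment is injective.
    let φ : ℕ → ℤ := fun i => min ⌊t i⌋ (B - 1)
    have hφ : ∀ i < N, (φ i : ℝ) ≤ t i ∧ t i ≤ φ i + 1 := by
      intro i hi
      have h1 := Int.floor_le (t i)
      have h2 := Int.lt_floor_add_one (t i)
      have h3 := (hmem i hi).2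
      rcases min_cases ⌊t i⌋ (B - 1) with ⟨h, h'⟩ | ⟨h, h'⟩ <;> simp only [φ, h]
      · exact ⟨h1, h2.le⟩
      · have h4 : ((B - 1 : ℤ) : ℝ) < (⌊t i⌋ : ℝ) := by exact_mod_cast h'
        push_cast at h4 ⊢
        exact ⟨by linarith, by linarith⟩
    have hne : ∀ i k, i < k → k < N → φ i ≠ φ k := by
      intro i k hik hk h
      have hz : ∀ i < N, f (t i) = 0 := fun i hi => by simpa using ht.zero i 0 hi rfl
      have h1 := hφ i (by omega)
      have h2 := hφ k hk
      have h3 := ht.mono (i + 1) k hik hk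
      rw [← h] at h2
      have h4 := hlt i (i + 1) (by omega) (by omega)
      obtain ⟨y, hy, hy0⟩ := ht.sep i (by omega) h4
      exact hy0 (hf.eq_zero_of_two_zeros hw h1.1 h4 (h3.trans h2.2) (hz i (by omega))
        (hz (i + 1) (by omega)) y ⟨h1.1.trans_lt hy.1, hy.2.trans_le (h3.trans h2.2)⟩)
    have hcard : (Finset.range N).card ≤ (Finset.Ico A B).card := by
      refine Finset.card_le_card_of_injOn φ (fun i hi => ?_) fun i hi k hk h => ?_
      · have h1 := (hmem i (by simpa using hi)).1
        have h2 : A ≤ ⌊t i⌋ := Int.le_floor.2 h1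
        simp only [Finset.coe_Ico, mem_Ico, φ, le_min_iff, min_lt_iff]
        omega
      · simp only [Finset.coe_range, mem_Iio] at hi hk
        rcases lt_trichotomy i k with h1 | h1 | h1
        · exact absurd h (hne i k h1 hk)
        · exact h1
        · exact absurd h.symm (hne k i h1 hi)
    simp only [Finset.card_range, Int.card_Ico] at hcard
    omega
  | succ n ih =>
    rcases N with _ | N
    · push_cast; omega
    -- Order and number of zeros both drop by one.
    · obtain ⟨t', ht', hmem'⟩ := ht.exists_deriv_div hw hf
      have := ih hw.tail (hf.deriv_div hw) ht' fun i hi =>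
        ⟨(hmem i (by omega)).1.trans (hmem' i hi).1, (hmem' i hi).2.trans (hmem _ (by omega)).2⟩
      push_cast
      omega

theorem IsSeparatedZeros.append {m N ν : ℕ} {f : ℝ → ℝ} {t : ℕ → ℝ} {z : ℝ}
    (ht : IsSeparatedZeros m f t N) (hlt : ∀ i < N, t i < z) (hν : ν ≤ m - 1)
    (hz : ∀ s < ν, iteratedDeriv s f z = 0)
    (hsep : ∀ i < N, ∃ y ∈ Ioo (t i) z, f y ≠ 0) :
    IsSeparatedZeros m f (fun i => if i < N then t i else z) (N + ν) := by
  refine ⟨fun i k hik hk => ?_, fun i s his h => ?_, fun i hi => ?_, fun i hi h => ?_⟩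
  · by_cases h1 : k < N
    · simpa [h1, hik.trans_lt h1] using ht.mono i k hik h1
    · by_cases h2 : i < N
      · simpa [h1, h2] using (hlt i h2).le
      · simp [h1, h2]
  · by_cases h1 : i + s < N
    · have h2 : i < N := by omega
      simp only [h1, h2, if_true] at h ⊢
      exact ht.zero i s h1 h
    · by_cases h2 : i < N
      · simp only [h1, h2, if_true, if_false] at h
        exact absurd h (hlt i h2).ne
      · simp only [h2, if_false]
        exact hz s (by omega)
  · by_cases h1 : i + (m - 1) < N
    · have h2 : i < N := by omega
      simpa only [h1, h2, if_true] using ht.mult i h1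
    · have h2 : i < N := by omega
      simpa only [h1, h2, if_true, if_false] using hlt i h2
  · by_cases h1 : i + 1 < N
    · have h2 : i < N := by omega
      simp only [h1, h2, if_true] at h ⊢
      exact ht.sep i h1 h
    · by_cases h2 : i < N
      · simp only [h1, h2, if_true, if_false]
        exact hsep i h2
      · simp only [h1, h2, if_false, lt_irrefl] at h

/-! ### Elements of the shift-invariant space as splines -/

/-- An integer shift multiplies the exponential factor by a constant and fixes the periodic factor.
-/
theorem IsPeriodicExponentialWeights.exists_comp_sub {m : ℕ} {w : ℕ → ℝ → ℝ}
    (hw : IsPeriodicExponentialWeights m w) (l : ℤ) {i : ℕ} (hi : i < m) :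
    ∃ c, ∀ x, w (1 + i) (x - l) = c * w (1 + i) x := by
  obtain ⟨γ, r, h⟩ := hw
  obtain ⟨-, h2, -, h4⟩ := h (1 + i) (by omega) (by omega)
  refine ⟨Real.exp (-γ (1 + i) * l), fun x => ?_⟩
  have h5 : r (1 + i) (x - l) = r (1 + i) x := by
    simpa using h2.sub_int_mul_eq l (x := x)
  rw [h4, h4, h5, mul_sub, sub_eq_add_neg, Real.exp_add, neg_mul]
  ring

theorem ofReal_eccSum_mem_eccSpace (w : ℕ → ℝ → ℝ) (m : ℕ) (a : ℕ → ℝ) :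
    (fun x => (eccSum w 1 m a x : ℂ)) ∈ eccSpace w m := by
  have : (fun x => (eccSum w 1 m a x : ℂ)) =
      ∑ i : Fin m, (a i : ℂ) • eccFunction w m i := by
    funext x
    simp only [eccSum, eccFunction, Finset.sum_apply, Pi.smul_apply, smul_eq_mul]
    push_cast
    exact Finset.sum_range fun i => (a i : ℂ) * (iteratedWeightIntegral w 1 i x : ℂ)
  rw [this]
  exact Submodule.sum_mem _ fun i _ => Submodule.smul_mem _ _ (Submodule.subset_span ⟨i, rfl⟩)

theorem comp_sub_mem_eccSpace {m : ℕ} {w : ℕ → ℝ → ℝ} (hw : IsPeriodicExponentialWeights m w)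
    (l : ℤ) {u : ℝ → ℂ} (hu : u ∈ eccSpace w m) : (fun x => u (x - l)) ∈ eccSpace w m := by
  induction hu using Submodule.span_induction with
  | mem u hu =>
    obtain ⟨i, rfl⟩ := hu
    obtain ⟨b, hb⟩ := exists_eccSum_comp_sub hw.isSmoothWeights l
      (fun i hi => hw.exists_comp_sub l hi) (Pi.single (i : ℕ) 1)
    have : (fun x : ℝ => eccFunction w m i (x - l)) = fun x => (eccSum w 1 m b x : ℂ) := by
      funext x
      rw [← hb]
      simp [eccSum, eccFunction, Pi.single_apply]
    rw [this]
    exact ofReal_eccSum_mem_eccSpace w m b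
  | zero => exact Submodule.zero_mem _
  | add u v _ _ hu hv => exact Submodule.add_mem _ hu hv
  | smul c u _ hu => exact Submodule.smul_mem _ c hu

theorem exists_finset_shift_sum {φ : ℝ → ℂ} {k : ℤ} {m : ℕ}
    (hφ : tsupport φ = Icc (k : ℝ) (k + m)) (c : ℤ → ℂ) (a b : ℝ) :
    ∃ S : Finset ℤ, ∀ y ∈ Icc a b,
      ∑' l : ℤ, c l * φ (y - l) = ∑ l ∈ S, c l * φ (y - l) := by
  refine ⟨Finset.Icc ⌊a - k - m⌋ ⌈b - k⌉, fun y hy => tsum_eq_sum fun l hl => ?_⟩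
  have : y - l ∉ tsupport φ := by
    rw [hφ]
    rintro ⟨h1, h2⟩
    refine hl (Finset.mem_Icc.2 ⟨?_, ?_⟩)
    · exact_mod_cast (Int.floor_le _).trans (by linarith [hy.1] : a - k - m ≤ (l : ℝ))
    · exact_mod_cast (by linarith [hy.2] : (l : ℝ) ≤ b - k).trans (Int.le_ceil _)
  rw [image_eq_zero_of_notMem_tsupport this, mul_zero]

/-- Shift-invariant spaces of periodic exponential B-splines consist of Chebyshev splines. -/
theorem IsChebyshevSpline.shift_sum {m : ℕ} {w : ℕ → ℝ → ℝ} {φ f : ℝ → ℂ} {k : ℤ}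
    (hw : IsPeriodicExponentialWeights m w) (hφ : IsChebyshevSpline w m φ)
    (hk : tsupport φ = Icc (k : ℝ) (k + m)) {c : ℤ → ℂ}
    (hf : ∀ x, f x = ∑' l : ℤ, c l * φ (x - l)) : IsChebyshevSpline w m f where
  contDiff hm := by
    refine contDiff_iff_contDiffAt.2 fun x => ?_
    obtain ⟨S, hS⟩ := exists_finset_shift_sum hk c (x - 1) (x + 1)
    have h1 : ContDiff ℝ ((m - 2 : ℕ) : WithTop ℕ∞) fun y : ℝ => ∑ l ∈ S, c l * φ (y - l) :=
      ContDiff.sum fun l _ => contDiff_const.mul ((hφ.contDiff hm).comp (by fun_prop))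
    refine h1.contDiffAt.congr_of_eventuallyEq ?_
    filter_upwards [Icc_mem_nhds (by linarith : x - 1 < x) (by linarith : x < x + 1)] with y hy
    rw [hf, hS y hy]
  piecewise j := by
    obtain ⟨S, hS⟩ := exists_finset_shift_sum hk c j (j + 1)
    choose u hu hφu using hφ.piecewise
    refine ⟨∑ l ∈ S, c l • fun x => u (j - l) (x - l), Submodule.sum_mem _ fun l _ =>
      Submodule.smul_mem _ _ (comp_sub_mem_eccSpace hw l (hu _)), fun x hx => ?_⟩
    rw [hf, hS x (Ioo_subset_Icc_self hx)]
    simp only [Finset.sum_apply, Pi.smul_apply, smul_eq_mul]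
    refine Finset.sum_congr rfl fun l _ => ?_
    rw [hφu (j - l)]
    push_cast
    exact ⟨by linarith [hx.1], by linarith [hx.2]⟩
  rightContinuous x := by
    obtain ⟨S, hS⟩ := exists_finset_shift_sum hk c x (x + 1)
    have h1 : ContinuousWithinAt (fun y : ℝ => ∑ l ∈ S, c l * φ (y - l)) (Ici x) x := by
      refine tendsto_finsetSum _ fun l _ => ContinuousWithinAt.mul continuousWithinAt_const ?_
      refine ContinuousWithinAt.comp (hφ.rightContinuous _) (by fun_prop) fun y hy => ?_
      exact sub_le_sub_right (mem_Ici.1 hy) _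
    refine h1.congr_of_eventuallyEq ?_ (by rw [hf, hS x ⟨le_rfl, by linarith⟩])
    filter_upwards [Icc_mem_nhdsGE (by linarith : x < x + 1)] with y hy
    rw [hf, hS y hy]

/-! ### Real parts, one-sided samples and vanishing -/

theorem contDiff_of_mem_eccSpace {m : ℕ} {w : ℕ → ℝ → ℝ} (hw : IsSmoothWeights w 1 m)
    {u : ℝ → ℂ} (hu : u ∈ eccSpace w m) : ContDiff ℝ ((m - 1 : ℕ) : WithTop ℕ∞) u := by
  induction hu using Submodule.span_induction with
  | mem u hu =>
    obtain ⟨i, rfl⟩ := hu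
    exact Complex.ofRealCLM.contDiff.comp (contDiff_iteratedWeightIntegral hw i.2)
  | zero => exact contDiff_const
  | add u v _ _ hu hv => exact hu.add hv
  | smul c u _ hu => exact contDiff_const.smul hu

/-- The basis functions are real-valued, so a real-linear functional acts on the coefficients only.
-/
theorem exists_eccSum_of_mem_eccSpace {m : ℕ} {w : ℕ → ℝ → ℝ} (L : ℂ →L[ℝ] ℝ)
    {u : ℝ → ℂ} (hu : u ∈ eccSpace w m) : ∃ a, ∀ x, L (u x) = eccSum w 1 m a x := by
  rw [eccSpace, Submodule.mem_span_range_iff_exists_fun] at hu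
  obtain ⟨c, rfl⟩ := hu
  refine ⟨fun i => if h : i < m then L (c ⟨i, h⟩) else 0, fun x => ?_⟩
  rw [eccSum, Finset.sum_range]
  simp only [Finset.sum_apply, Pi.smul_apply, smul_eq_mul, map_sum, eccFunction, Fin.is_lt,
    dite_true, Fin.eta]
  refine Finset.sum_congr rfl fun i _ => ?_
  rw [mul_comm, ← Complex.real_smul, map_smul, smul_eq_mul, mul_comm]

theorem IsChebyshevSpline.isRealSpline {m : ℕ} {w : ℕ → ℝ → ℝ} {f : ℝ → ℂ}
    (hf : IsChebyshevSpline w m f) (L : ℂ →L[ℝ] ℝ) : IsRealSpline w 1 m (L ∘ f) where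
  contDiff hm := L.contDiff.comp (hf.contDiff hm)
  piecewise k := by
    obtain ⟨u, hu, hfu⟩ := hf.piecewise k
    obtain ⟨a, ha⟩ := exists_eccSum_of_mem_eccSpace L hu
    exact ⟨a, fun x hx => by rw [← ha, ← hfu hx, Function.comp_apply]⟩

theorem iteratedDeriv_clm_comp (L : ℂ →L[ℝ] ℝ) {f : ℝ → ℂ} {s : ℕ} {x : ℝ}
    (hf : ContDiffAt ℝ (s : WithTop ℕ∞) f x) :
    iteratedDeriv s (L ∘ f) x = L (iteratedDeriv s f x) := by
  simp [iteratedDeriv_eq_iteratedFDeriv, L.iteratedFDeriv_comp_left hf le_rfl]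

theorem Ioo_mem_nhdsGT_floor (x : ℝ) : Ioo (⌊x⌋ : ℝ) (⌊x⌋ + 1) ∈ 𝓝[>] x :=
  mem_of_superset (Ioo_mem_nhdsGT (Int.lt_floor_add_one x)) (Ioo_subset_Ioo_left (Int.floor_le x))

theorem IsChebyshevSpline.tendsto_iteratedDeriv_comp {m : ℕ} {w : ℕ → ℝ → ℝ} {f : ℝ → ℂ}
    (hw : IsSmoothWeights w 1 m) (hf : IsChebyshevSpline w m f) (L : ℂ →L[ℝ] ℝ) {s : ℕ}
    (hs : s ≤ m - 1) {x : ℝ} (h : HasSample f s x 0) :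
    Tendsto (iteratedDeriv s (L ∘ f)) (𝓝[>] x) (𝓝 0) := by
  have h1 : Tendsto (fun y => L (iteratedDeriv s f y)) (𝓝[>] x) (𝓝 0) := by
    simpa [Function.comp_def] using (L.continuous.tendsto 0).comp h
  refine h1.congr' ?_
  obtain ⟨u, hu, hfu⟩ := hf.piecewise ⌊x⌋
  filter_upwards [Ioo_mem_nhdsGT_floor x] with y hy
  refine (iteratedDeriv_clm_comp L ?_).symm
  have h2 := (contDiff_of_mem_eccSpace hw hu).of_le (Nat.cast_le.2 hs)
  exact h2.contDiffAt.congr_of_eventuallyEq (eventually_of_mem (isOpen_Ioo.mem_nhds hy) hfu)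

/-- The piece to the right of `x` extends smoothly across `x`, so the one-sided limits are
derivatives of that extension, which then has a zero of order `m`. -/
theorem IsRealSpline.eq_zero_of_tendsto {w : ℕ → ℝ → ℝ} {j m : ℕ} {g : ℝ → ℝ}
    (hw : IsSmoothWeights w j m) (hg : IsRealSpline w j m g) {x : ℝ}
    (h : ∀ s < m, Tendsto (iteratedDeriv s g) (𝓝[>] x) (𝓝 0)) :
    ∀ y ∈ Ioo (⌊x⌋ : ℝ) (⌊x⌋ + 1), g y = 0 := by
  obtain ⟨a, ha⟩ := hg.piecewise ⌊x⌋
  have hc := contDiff_eccSum hw a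
  intro y hy
  rw [ha hy]
  refine eccSum_eq_zero hw (y := x) (fun s hs => ?_) y
  have h1 : Tendsto (iteratedDeriv s (eccSum w j m a)) (𝓝[>] x) (𝓝 0) := by
    refine (h s hs).congr' ?_
    filter_upwards [Ioo_mem_nhdsGT_floor x] with z hz
    exact ha.iteratedDeriv_of_isOpen isOpen_Ioo s hz
  have h2 : Continuous (iteratedDeriv s (eccSum w j m a)) :=
    hc.continuous_iteratedDeriv s (Nat.cast_le.2 (by omega))
  exact tendsto_nhds_unique ((h2.tendsto x).mono_left nhdsWithin_le_nhds) h1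

theorem IsRealSpline.continuous_iteratedDeriv {w : ℕ → ℝ → ℝ} {j m s : ℕ} {g : ℝ → ℝ}
    (hg : IsRealSpline w j m g) (hs : s < m - 1) : Continuous (iteratedDeriv s g) :=
  (hg.contDiff (by omega)).continuous_iteratedDeriv s (Nat.cast_le.2 (by omega))

theorem IsRealSpline.iteratedDeriv_eq_zero_of_tendsto {w : ℕ → ℝ → ℝ} {j m s : ℕ} {g : ℝ → ℝ}
    (hg : IsRealSpline w j m g) (hs : s < m - 1) {x : ℝ} {l : Filter ℝ} [l.NeBot] (hl : l ≤ 𝓝 x)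
    (h : Tendsto (iteratedDeriv s g) l (𝓝 0)) : iteratedDeriv s g x = 0 :=
  tendsto_nhds_unique (((hg.continuous_iteratedDeriv hs).tendsto x).mono_left hl) h

/-- Supplies the zeros of order `m - 1` at the ends of a vanishing interval. -/
theorem IsRealSpline.iteratedDeriv_eq_zero_of_eqOn {w : ℕ → ℝ → ℝ} {j m s : ℕ} {g : ℝ → ℝ}
    (hg : IsRealSpline w j m g) (hs : s < m - 1) {x c d : ℝ} (hcd : c < d) (hx : x ∈ Icc c d)
    (h : ∀ y ∈ Ioo c d, g y = 0) : iteratedDeriv s g x = 0 := by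
  have h0 : EqOn (iteratedDeriv s g) (fun _ => 0) (Ioo c d) := fun y hy => by
    have h1 : EqOn g (fun _ => 0) (Ioo c d) := h
    rw [h1.iteratedDeriv_of_isOpen isOpen_Ioo s hy, iteratedDeriv_fun_const_zero]
  have := h0.closure (hg.continuous_iteratedDeriv hs) continuous_const
  rw [closure_Ioo hcd.ne] at this
  exact this hx

theorem IsRealSpline.exists_ne_zero {w : ℕ → ℝ → ℝ} {j m : ℕ} {g : ℝ → ℝ}
    (hw : IsSmoothWeights w j m) (hg : IsRealSpline w j m g) {A B : ℤ}
    (hV : ∀ k, A ≤ k → k < B → ¬∀ y ∈ Ioo (k : ℝ) (k + 1), g y = 0) {c d : ℝ}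
    (hc : (A : ℝ) ≤ c) (hcd : c < d) (hd : d ≤ B) : ∃ y ∈ Ioo c d, g y ≠ 0 := by
  by_contra! hcon
  have h1 : (⌊c⌋ : ℝ) < B := (Int.floor_le c).trans_lt (hcd.trans_le hd)
  refine hV ⌊c⌋ (Int.le_floor.2 hc) (by exact_mod_cast h1) fun y hy => ?_
  obtain ⟨a, ha⟩ := hg.piecewise ⌊c⌋
  rw [ha hy]
  refine eccSum_eq_zero_of_eqOn_Ioo hw (lt_min hcd (Int.lt_floor_add_one c)) (fun z hz => ?_) y
  rw [← ha ⟨(Int.floor_le c).trans_lt hz.1, hz.2.trans_le (min_le_right _ _)⟩]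
  exact hcon z ⟨hz.1, hz.2.trans_le (min_le_left _ _)⟩

/-! ### Zero count with boundary zeros -/

theorem IsSeparatedZeros.append_blocks {m N : ℕ} {g : ℝ → ℝ} {t : ℕ → ℝ}
    (ht : IsSeparatedZeros m g t N) {A B : ℝ}
    (hsep : ∀ c d, A ≤ c → c < d → d ≤ B → ∃ y ∈ Ioo c d, g y ≠ 0) {K : ℕ} {y : ℕ → ℝ}
    (hy : ∀ k < K, y k ∈ Ioo A B) (hmono : StrictMono y) {ν : ℕ → ℕ}
    (hν : ∀ k < K, ν k ≤ m - 1)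
    (hz : ∀ k < K, ∀ s < ν k, iteratedDeriv s g (y k) = 0) (hA : A < B)
    (htA : ∀ i < N, t i = A) {n : ℕ} (hn : n ≤ K) :
    ∃ t', IsSeparatedZeros m g t' (N + ∑ k ∈ Finset.range n, ν k) ∧
      ∀ i < N + ∑ k ∈ Finset.range n, ν k, t' i ∈ Ico A B ∧ ∀ k, n ≤ k → k < K → t' i < y k := by
  induction n with
  | zero =>
    refine ⟨t, by simpa using ht, fun i hi => ?_⟩
    rw [htA i (by simpa using hi)]
    exact ⟨⟨le_rfl, hA⟩, fun k _ hk => (hy k hk).1⟩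
  | succ n ih =>
    obtain ⟨t', ht', h⟩ := ih (by omega)
    have hyn := hy n hn
    refine ⟨_, Finset.sum_range_succ ν n ▸ add_assoc N _ _ ▸
      ht'.append (fun i hi => (h i hi).2 n le_rfl hn) (hν n hn) (hz n hn)
      fun i hi => hsep _ _ (h i hi).1.1 ((h i hi).2 n le_rfl hn) hyn.2.le, fun i _ => ?_⟩
    split_ifs with hi
    · exact ⟨(h i hi).1, fun k hk hkK => (h i hi).2 k (by omega) hkK⟩
    · exact ⟨⟨hyn.1.le, hyn.2⟩, fun k hk _ => hmono (by omega)⟩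

/-- Zero count with boundary zeros: if the spline vanishes identically on no knot interval
in `[A, B]`, the zeros in `(A, B)` together with zeros of orders `α` and `β` at the endpoints
number at most `B - A + m - 2`. -/
theorem IsRealSpline.card_zeros_le {w : ℕ → ℝ → ℝ} {j m : ℕ} (hm : 1 ≤ m) {g : ℝ → ℝ}
    (hw : IsSmoothWeights w j m) (hg : IsRealSpline w j m g) {A B : ℤ} (hAB : A < B)
    (hV : ∀ k, A ≤ k → k < B → ¬∀ y ∈ Ioo (k : ℝ) (k + 1), g y = 0) {K : ℕ} {y : ℕ → ℝ}
    (hy : ∀ k < K, y k ∈ Ioo (A : ℝ) B) (hmono : StrictMono y) {ν : ℕ → ℕ}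
    (hν1 : ∀ k < K, 1 ≤ ν k) (hν : ∀ k < K, ν k ≤ m - 1)
    (hz : ∀ k < K, ∀ s < ν k, iteratedDeriv s g (y k) = 0) {α β : ℕ} (hα : α ≤ m - 1)
    (hβ : β ≤ m - 1) (hgA : ∀ s < α, iteratedDeriv s g A = 0)
    (hgB : ∀ s < β, iteratedDeriv s g B = 0) :
    ((α + ∑ k ∈ Finset.range K, ν k + β : ℕ) : ℤ) + 2 ≤ B - A + m := by
  have hAB' : (A : ℝ) < B := by exact_mod_cast hAB
  obtain rfl | ⟨n, rfl⟩ : m = 1 ∨ ∃ n, m = n + 2 := by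
    rcases m with _ | _ | n
    · omega
    · exact Or.inl rfl
    · exact Or.inr ⟨n, rfl⟩
  -- For order one, `1 ≤ ν k ≤ m - 1` is impossible, so there are no interior zeros to count.
  · have hK : K = 0 := by
      by_contra hK
      have h1 := hν1 0 (by omega)
      have h2 := hν 0 (by omega)
      omega
    subst hK
    simp only [Finset.range_zero, Finset.sum_empty]
    omega
  · have hsep := fun c d hc hcd hd => hg.exists_ne_zero hw hV (c := c) (d := d) hc hcd hd
    have h0 : IsSeparatedZeros (n + 2) g (fun _ => (A : ℝ)) 0 :=
      ⟨by simp, by simp, by simp, by simp⟩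
    have h1 := h0.append (z := A) (by simp) hα hgA (by simp)
    obtain ⟨t, ht, htm⟩ := h1.append_blocks hsep hy hmono hν hz hAB' (by simp) le_rfl
    have h2 := ht.append (fun i hi => (htm i hi).1.2) hβ hgB
      fun i hi => hsep _ _ (htm i hi).1.1 (htm i hi).1.2 le_rfl
    have h3 := h2.card_le hw hg hAB fun i _ => by
      split_ifs with hi
      · exact ⟨(htm i hi).1.1, (htm i hi).1.2.le⟩
      · exact ⟨hAB'.le, le_rfl⟩
    push_cast at h3 ⊢
    omega

/-! ### The gap condition against the zero count -/

theorem add_mul_le_of_separated {x : ℤ → ℝ} {δ : ℝ} (h : ∀ j, x j + δ ≤ x (j + 1)) (j : ℤ)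
    (n : ℕ) : x j + n * δ ≤ x (j + n) := by
  induction n with
  | zero => simp
  | succ n ih =>
    have := h (j + n)
    push_cast
    rw [← add_assoc]
    linarith

/-- The points of a sequence with weighted gaps at most `θ` in an interval `(A, B)`. -/
theorem exists_points_of_gap_le {x : ℤ → ℝ} {δ θ : ℝ} (hδ : 0 < δ)
    (hx : ∀ j, x j + δ ≤ x (j + 1)) {ν : ℤ → ℕ} {m : ℕ} (hν : ∀ j, ν j ≤ m) (hθ : 0 ≤ θ)
    (hgap : ∀ j, x (j + 1) - x j ≤ θ * ν (j + 1)) {A B : ℝ} (hAB : A < B) :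
    ∃ (p : ℤ) (K : ℕ), (∀ k < K, x (p + (k : ℕ)) ∈ Ioo A B) ∧
      B - A ≤ θ * ((∑ k ∈ Finset.range K, ν (p + (k : ℕ)) : ℕ) + m) := by
  have hsm : StrictMono x := strictMono_int_of_lt_succ fun j => by linarith [hx j]
  have hup : ∀ C, ∃ q, C ≤ x q := fun C => by
    obtain ⟨n, hn⟩ := exists_nat_ge ((C - x 0) / δ)
    rw [div_le_iff₀ hδ] at hn
    exact ⟨0 + n, by linarith [add_mul_le_of_separated hx 0 n]⟩
  have hdown : ∀ C, ∃ b, ∀ q, C ≤ x q → b ≤ q := fun C => by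
    obtain ⟨n, hn⟩ := exists_nat_gt ((x 0 - C) / δ)
    rw [div_lt_iff₀ hδ] at hn
    refine ⟨-n, fun q hq => ?_⟩
    by_contra! hlt
    have h1 := add_mul_le_of_separated hx (-n) n
    rw [neg_add_cancel] at h1
    linarith [hsm hlt]
  obtain ⟨p, hp, hp'⟩ := Int.exists_least_of_bdd (P := fun q => A < x q)
    ((hdown A).imp fun b hb q hq => hb q hq.le)
    ((hup (A + 1)).imp fun q hq => by linarith)
  obtain ⟨q, hq, hq'⟩ := Int.exists_least_of_bdd (P := fun q => B ≤ x q) (hdown B) (hup B)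
  have hpq : p ≤ q := hp' q (hAB.trans_le hq)
  obtain ⟨K, rfl⟩ : ∃ K : ℕ, q = p + K := ⟨(q - p).toNat, by omega⟩
  -- Each gap is charged to its right endpoint. The last gap, ending at `x (p + K) ≥ B`, is charged
  -- to a point outside `(A, B)` and accounts for the extra `m` in the bound.
  have hsum : ∀ n : ℕ, x (p + n - 1) - x (p - 1) ≤
      θ * (∑ k ∈ Finset.range n, ν (p + (k : ℕ)) : ℕ) := by
    intro n
    induction n with
    | zero => simp
    | succ n ih =>
      have := hgap (p + n - 1)
      rw [sub_add_cancel] at this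
      rw [Finset.sum_range_succ]
      push_cast at ih ⊢
      rw [← add_assoc, add_sub_cancel_right, mul_add]
      linarith
  refine ⟨p, K, fun k hk => ⟨?_, ?_⟩, ?_⟩
  · exact hp.trans_le (hsm.monotone (by omega))
  · by_contra! h
    have := hq' _ h
    omega
  · have h1 : x (p - 1) ≤ A := by
      by_contra! h
      have := hp' _ h
      omega
    have h2 := hsum K
    have h3 := hgap (p + K - 1)
    rw [sub_add_cancel] at h3
    have h4 : θ * ν (p + K) ≤ θ * m :=
      mul_le_mul_of_nonneg_left (Nat.cast_le.2 (hν _)) hθ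
    rw [mul_add]
    linarith

theorem IsRealSpline.eq_zero_of_gap {w : ℕ → ℝ → ℝ} {j m : ℕ} (hm : 1 ≤ m) {g : ℝ → ℝ}
    (hw : IsSmoothWeights w j m) (hg : IsRealSpline w j m g)
    (hr : ∀ x, ContinuousWithinAt g (Ici x) x) {x : ℤ → ℝ} {δ θ : ℝ} (hδ : 0 < δ)
    (hx : ∀ i, x i + δ ≤ x (i + 1)) {ν : ℤ → ℕ} (hν1 : ∀ i, 1 ≤ ν i) (hν : ∀ i, ν i ≤ m)
    (hθ : 0 ≤ θ) (hθ1 : θ < 1) (hgap : ∀ i, x (i + 1) - x i ≤ θ * ν (i + 1))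
    (hz : ∀ i, ∀ s < ν i, Tendsto (iteratedDeriv s g) (𝓝[>] x i) (𝓝 0)) : g = 0 := by
  have hsm : StrictMono x := strictMono_int_of_lt_succ fun i => by linarith [hx i]
  let V : ℤ → Prop := fun k => ∀ y ∈ Ioo (k : ℝ) (k + 1), g y = 0
  have hcount : ∀ A B : ℤ, A < B → (∀ k, A ≤ k → k < B → ¬V k) → ∀ α β : ℕ, α ≤ m - 1 →
      β ≤ m - 1 → (∀ s < α, iteratedDeriv s g A = 0) → (∀ s < β, iteratedDeriv s g B = 0) →
      ∃ Z : ℕ, ((α + Z + β : ℕ) : ℤ) + 2 ≤ B - A + m ∧ ((B : ℝ) - A) ≤ θ * (Z + m) := by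
    intro A B hAB hV α β hα hβ hA hB
    obtain ⟨p, K, h1, h2⟩ := exists_points_of_gap_le hδ hx hν hθ hgap
      (by exact_mod_cast hAB : (A : ℝ) < B)
    -- A sample of full multiplicity `m` would annihilate the knot interval to its right.
    have h3 : ∀ k < K, ν (p + (k : ℕ)) ≤ m - 1 := by
      intro k hk
      by_contra! hlt
      refine hV ⌊x (p + (k : ℕ))⌋ (Int.le_floor.2 (h1 k hk).1.le)
        (Int.floor_lt.2 (h1 k hk).2) (hg.eq_zero_of_tendsto hw fun s hs => hz _ s (by omega))
    refine ⟨_, hg.card_zeros_le hm hw hAB hV (y := fun k => x (p + (k : ℕ))) h1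
      (fun a b hab => hsm (by omega)) (ν := fun k => ν (p + (k : ℕ)))
      (fun k _ => hν1 _) h3 (fun k hk s hs => ?_) hα hβ hA hB, h2⟩
    exact hg.iteratedDeriv_eq_zero_of_tendsto (hs.trans_le (h3 k hk)) nhdsWithin_le_nhds
      (hz _ s hs)
  by_contra hg0
  obtain ⟨y, hy⟩ := Function.ne_iff.1 hg0
  -- Right-continuity covers the case where `y` is itself a knot.
  have hk0 : ¬V ⌊y⌋ := by
    intro hV
    have h1 : Tendsto g (𝓝[>] y) (𝓝 (g y)) :=
      (hr y).tendsto.mono_left (nhdsWithin_mono _ Ioi_subset_Ici_self)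
    have h2 : g =ᶠ[𝓝[>] y] fun _ => 0 := eventually_of_mem (Ioo_mem_nhdsGT_floor y) hV
    exact hy (tendsto_nhds_unique (h1.congr' h2) tendsto_const_nhds)
  -- Eliminating `Z` from the two estimates without boundary zeros gives `(B - A) (1 - θ) ≤ 2 m θ`.
  obtain ⟨M, hM⟩ : ∃ M : ℕ, ∀ A B : ℤ, A < B → (∀ k, A ≤ k → k < B → ¬V k) → B - A < M := by
    obtain ⟨M, hM⟩ := exists_nat_gt (θ * (2 * m) / (1 - θ))
    rw [div_lt_iff₀ (by linarith)] at hM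
    refine ⟨M, fun A B hAB hV => ?_⟩
    obtain ⟨Z, h1, h2⟩ := hcount A B hAB hV 0 0 (by omega) (by omega) (by simp) (by simp)
    have h3 : (Z : ℝ) + 2 ≤ B - A + m := by
      simp only [zero_add, add_zero] at h1
      exact_mod_cast h1
    have h4 : θ * (Z + m) ≤ θ * (B - A + 2 * m) := mul_le_mul_of_nonneg_left (by linarith) hθ
    have h5 : ((B : ℝ) - A) * (1 - θ) < M * (1 - θ) := by linarith
    have h6 := lt_of_mul_lt_mul_right h5 (by linarith)
    exact_mod_cast h6
  have hlow : ∃ k, k < ⌊y⌋ ∧ V k := by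
    by_contra! h
    have := hM (⌊y⌋ - M) (⌊y⌋ + 1) (by omega) fun k _ hk => by
      rcases (Int.lt_add_one_iff.1 hk).eq_or_lt with rfl | hk
      · exact hk0
      · exact h k hk
    omega
  have hhigh : ∃ k, ⌊y⌋ < k ∧ V k := by
    by_contra! h
    have := hM ⌊y⌋ (⌊y⌋ + 1 + M) (by omega) fun k hk _ => by
      rcases hk.eq_or_lt with rfl | hk
      · exact hk0
      · exact h k hk
    omega
  obtain ⟨a, ⟨ha, haV⟩, ha'⟩ := Int.exists_greatest_of_bdd
    (P := fun k => k < ⌊y⌋ ∧ V k) ⟨⌊y⌋, fun k hk => hk.1.le⟩ hlow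
  obtain ⟨b, ⟨hb, hbV⟩, hb'⟩ := Int.exists_least_of_bdd
    (P := fun k => ⌊y⌋ < k ∧ V k) ⟨⌊y⌋, fun k hk => hk.1.le⟩ hhigh
  -- The knot intervals at `a` and `b` are the nearest vanishing ones, so `[a + 1, b]` is maximal
  -- and both ends carry zeros of order `m - 1`.
  obtain ⟨Z, h1, h2⟩ := hcount (a + 1) b (by omega) (fun k hak hkb hk => by
      rcases lt_trichotomy k ⌊y⌋ with h | rfl | h
      · have := ha' k ⟨h, hk⟩
        omega
      · exact hk0 hk
      · have := hb' k ⟨h, hk⟩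
        omega) (m - 1) (m - 1) le_rfl le_rfl
    (fun s hs => hg.iteratedDeriv_eq_zero_of_eqOn hs (lt_add_one (a : ℝ)) (by push_cast; simp) haV)
    (fun s hs => hg.iteratedDeriv_eq_zero_of_eqOn hs (lt_add_one (b : ℝ)) (by simp) hbV)
  have h3 : (Z : ℤ) + m ≤ b - (a + 1 : ℤ) := by omega
  have h4 : (Z : ℝ) + m ≤ b - (a + 1 : ℤ) := by exact_mod_cast h3
  have h5 : (1 : ℝ) ≤ m := by exact_mod_cast hm
  -- `Z + m ≤ θ (Z + m)` is impossible since `θ < 1` and `Z + m ≥ 1`.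
  nlinarith [(Nat.cast_nonneg Z : (0 : ℝ) ≤ Z)]

theorem exists_gap_bound {X : Set ℝ} {x : ℤ ≃o X} {μ : X → ℕ} (hgap : weightedMaxGap x μ < 1) :
    ∃ θ : ℝ, 0 ≤ θ ∧ θ < 1 ∧
      ∀ j, (x (j + 1) : ℝ) - x j ≤ θ * ((1 + μ (x (j + 1)) : ℕ) : ℝ) := by
  obtain ⟨θ, h1, h2⟩ := EReal.lt_iff_exists_real_btwn.1 hgap
  have hle : ∀ j, ((x (j + 1) : ℝ) - x j) / (1 + μ (x (j + 1))) ≤ θ := fun j => by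
    have h3 := (le_iSup (fun j : ℤ =>
      ((((x (j + 1) : ℝ) - x j) / (1 + μ (x (j + 1))) : ℝ) : EReal)) j).trans (le_max_right
      (⨆ j : ℤ, ((((x (j + 1) : ℝ) - x j) / (1 + μ (x j)) : ℝ) : EReal)) _)
    exact EReal.coe_le_coe_iff.1 (h3.trans h1.le)
  refine ⟨θ, le_trans ?_ (hle 0), by exact_mod_cast h2, fun j => ?_⟩
  · exact div_nonneg (sub_nonneg.2 (x.monotone (by norm_num))) (by positivity)
  · have := hle j
    rw [div_le_iff₀ (by positivity)] at this
    push_cast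
    exact this

theorem theorem6p2 (m : ℕ) (hm : 1 ≤ m) (φ : ℝ → ℂ) (hφ : IsPEBSpline m φ)
    (X : Set ℝ) (hX : IsSeparatedSet X) (x : ℤ ≃o X)
    (μ : X → ℕ) (hμ : ∀ y, μ y ≤ m - 1)
    (hgap : weightedMaxGap x μ < 1)
    (p : ENNReal) (hp : 1 ≤ p) :
    IsUniquenessSet X μ (shiftInvariantSpace p φ) := by
  obtain ⟨w, hw, hφw, k, hk⟩ := hφ
  obtain ⟨δ, hδ, hX⟩ := hX
  obtain ⟨θ, hθ, hθ1, hθgap⟩ := exists_gap_bound hgap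
  have hsep : ∀ j, (x j : ℝ) + δ ≤ x (j + 1) := fun j => by
    have h1 : (x j : ℝ) < x (j + 1) := x.strictMono (lt_add_one j)
    have h2 : δ ≤ |(x (j + 1) : ℝ) - x j| := hX (x (j + 1)).2 (x j).2 h1.ne'
    rw [abs_of_pos (sub_pos.2 h1)] at h2
    linarith
  rintro f ⟨-, c, -, hfc⟩
  refine ⟨fun h => ?_, fun h y s _ => ?_⟩
  · have hf : IsChebyshevSpline w m f := hφw.shift_sum hw hk hfc
    have key : ∀ L : ℂ →L[ℝ] ℝ, L ∘ f = 0 := fun L =>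
      (hf.isRealSpline L).eq_zero_of_gap hm hw.isSmoothWeights
        (fun y => L.continuous.continuousAt.comp_continuousWithinAt (hf.rightContinuous y)) hδ
        hsep (ν := fun j => 1 + μ (x j)) (fun j => by omega)
        (fun j => by have := hμ (x j); omega) hθ hθ1 hθgap
        fun j s hs => hf.tendsto_iteratedDeriv_comp hw.isSmoothWeights L
          (by have := hμ (x j); omega) (h (x j) s (by omega))
    funext y
    exact Complex.ext (congrFun (key Complex.reCLM) y) (congrFun (key Complex.imCLM) y)
  · subst h
    have : iteratedDeriv s (0 : ℝ → ℂ) = fun _ => 0 := funext fun z => iteratedDeriv_const_zero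
    rw [HasSample, this]
    exact tendsto_const_nhds
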